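/- For every integer $n\ge 1$ there exist finite constants $\mathcal A_n,\mathcal B_n\ge 0$, depending only on $n$, such that the following holds. Let $\mathfrak M^{n\times n}(\mathbb R)$ be the space of real $n\times n$ matrices and let $|E|$ denote the Lebesgue measure of $E\subset\mathfrak M^{n\times n}(\mathbb R)\cong\mathbb R^{n^2}$. Suprema are taken in $[0,\infty]$ (so they may be $+\infty$, and the supremum over the empty set is $0$). (A) For every Lebesgue measurable set $E\subset \mathfrak M^{n\times n}(\mathbb R)$ of finite measure and all nonzero scalars $\lambda_1,\dots,\lambda_n\in\mathbb R$, $$\Big(\prod_{j=1}^n|\lambda_j|\Big)\,|E|^{1/n}\le \mathcal A_n\,\sup_{A_1,\dots,A_n\in E}\big|\det(\lambda_1A_1+\cdots+\lambda_nA_n)\big| .$$ (B) For every compact convex set $E\subset \mathfrak M^{n\times n}(\mathbb R)$, $$|E|^{1/n}\le \mathcal B_n\,\sup_{A\in E}|\det A| .$$ -/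

import Mathlib

open MeasureTheory
open scoped NNReal ENNReal

/-- The product (Borel) sigma-algebra on `n × n` real matrices, entry by entry. -/
instance matrixMeasurableSpace (n : ℕ) : MeasurableSpace (Matrix (Fin n) (Fin n) ℝ) :=
  (MeasurableSpace.pi : MeasurableSpace (Fin n → Fin n → ℝ))

/-- Lebesgue measure on the space of `n × n` real matrices, identified entrywise with
`ℝ^(n²)`. -/
noncomputable def matrixVolume (n : ℕ) : Measure (Matrix (Fin n) (Fin n) ℝ) :=
  (volume : Measure (Fin n → Fin n → ℝ)).map Matrix.of

/-! Iterated differences of det(∑ c_j A_j) over points of E isolate its multilinear part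
(`mixedDet_sub`), so a bound t on these determinants bounds the polarized determinant by S = 2^n t /
∏|c_j| on tuples from a translate F of E. By multilinearity the bound passes to K, the convex hull
of F ∪ -F, giving |det| ≤ S on K.

Take A in K with |det A| above half the supremum, and Q = A⁻¹. For X in K, det(1 + tQX) is bounded
for |t| ≤ 1, hence so is tr((QX)²) (`exists_abs_trace_sq_le`), and polarizing bounds the form
tr(QXQY) on K. Its Gram determinant on n² matrices is ± the squared determinant of their coordinates
times det(Q)^(2n) (`det_sq_mul_det_pow_le`), so coordinate determinants on F are O(S^n), and so is
the volume (`volume_le_of_abs_det_le`). An n-th root gives (A). For (B), take c_j = 1/n: convexity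
keeps the averages in E. -/

/-! ### Polarization of the determinant -/

/-- The polarization of the determinant: `n!` times the mixed discriminant. -/
noncomputable def mixedDet (n : ℕ) :
    MultilinearMap ℝ (fun _ : Fin n => Matrix (Fin n) (Fin n) ℝ) ℝ :=
  ∑ σ : Equiv.Perm (Fin n),
    ((Matrix.detRowAlternating (n := Fin n) (R := ℝ)).toMultilinearMap.compLinearMap
      (fun i => (LinearMap.proj i : (Fin n → Fin n → ℝ) →ₗ[ℝ] (Fin n → ℝ)))).domDomCongr σ

theorem mixedDet_apply {n : ℕ} (M : Fin n → Matrix (Fin n) (Fin n) ℝ) :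
    mixedDet n M = ∑ σ : Equiv.Perm (Fin n), (Matrix.of fun i => M (σ i) i).det := by
  simp only [mixedDet, _root_.sum_apply]
  rfl

theorem mixedDet_const {n : ℕ} (A : Matrix (Fin n) (Fin n) ℝ) :
    mixedDet n (fun _ => A) = n.factorial * A.det := by
  rw [mixedDet_apply]
  have h : (Matrix.of fun i => A i) = A := rfl
  simp [h, Fintype.card_perm]

theorem det_sum_eq_sum_det_rows {n : ℕ} (M : Fin n → Matrix (Fin n) (Fin n) ℝ) :
    (∑ j, M j).det = ∑ f : Fin n → Fin n, (Matrix.of fun i => M (f i) i).det := by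
  have h := (Matrix.detRowAlternating (n := Fin n) (R := ℝ)).toMultilinearMap.map_sum
    (fun i j => M j i)
  have e : (∑ j, M j) = (fun i => ∑ j, M j i : Fin n → Fin n → ℝ) := by
    ext i k
    simp [Matrix.sum_apply]
  rw [e]
  exact h

/-- If f misses j, toggling j in s changes no row but flips the sign, so the terms cancel in pairs.
Only permutations survive in `mixedDet_sub`. -/
theorem sum_sign_det_rows_of_not_surjective {n : ℕ} (A A' : Fin n → Matrix (Fin n) (Fin n) ℝ)
    (f : Fin n → Fin n) (hf : ¬ Function.Surjective f) :
    ∑ s : Finset (Fin n), (-1 : ℝ) ^ s.card *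
      (Matrix.of fun i => (s.piecewise A' A) (f i) i).det = 0 := by
  classical
  simp only [Function.Surjective, not_forall, not_exists] at hf
  obtain ⟨j, hj⟩ := hf
  refine Finset.sum_involution (fun s _ => if j ∈ s then s.erase j else insert j s) ?_ ?_ ?_ ?_
  · intro s _
    have key : ∀ t : Finset (Fin n), j ∉ t →
        (Matrix.of fun i => ((insert j t).piecewise A' A) (f i) i).det =
          (Matrix.of fun i => (t.piecewise A' A) (f i) i).det := by
      intro t ht
      congr 2
      funext i
      simp [Finset.piecewise, hj i]
    by_cases h : j ∈ s
    · have h1 := key (s.erase j) (by simp)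
      rw [Finset.insert_erase h] at h1
      have hc : s.card = (s.erase j).card + 1 := (Finset.card_erase_add_one h).symm
      rw [show (if j ∈ s then s.erase j else insert j s) = s.erase j from if_pos h, h1, hc, pow_succ]
      ring
    · rw [show (if j ∈ s then s.erase j else insert j s) = insert j s from if_neg h, key s h,
        Finset.card_insert_of_notMem h, pow_succ]
      ring
  · intro s _ _ h
    by_cases hs : j ∈ s
    · simp only [hs, if_true] at h
      exact (Finset.erase_ne_self.2 hs) h
    · simp only [hs, if_false] at h
      exact (Finset.insert_ne_self.2 hs) h
  · simp
  · intro s _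
    by_cases hs : j ∈ s
    · simp [hs]
    · simp [hs]

theorem MultilinearMap.map_sub_eq_sum {ι V : Type*} [Fintype ι] [DecidableEq ι] [AddCommGroup V]
    [Module ℝ V] (P : MultilinearMap ℝ (fun _ : ι => V) ℝ) (A A' : ι → V) :
    P (A - A') = ∑ s : Finset ι, (-1 : ℝ) ^ s.card * P (s.piecewise A' A) := by
  have h : A - A' = -A' + A := by abel
  rw [h, P.map_add_univ]
  refine Finset.sum_congr rfl fun s _ => ?_
  have h2 := P.map_piecewise_smul (fun _ => (-1 : ℝ)) (s.piecewise A' A) s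
  have e : s.piecewise (-A') A = s.piecewise (fun i => (-1 : ℝ) • s.piecewise A' A i)
      (s.piecewise A' A) := by
    funext i
    by_cases hi : i ∈ s <;> simp [hi]
  rw [e, h2]
  simp

/-- Iterated differences of the determinant of a sum recover its polarization. -/
theorem mixedDet_sub {n : ℕ} (A A' : Fin n → Matrix (Fin n) (Fin n) ℝ) :
    mixedDet n (A - A') =
      ∑ s : Finset (Fin n), (-1 : ℝ) ^ s.card * (∑ j, s.piecewise A' A j).det := by
  classical
  simp_rw [det_sum_eq_sum_det_rows, Finset.mul_sum]
  rw [Finset.sum_comm, MultilinearMap.map_sub_eq_sum]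
  simp_rw [mixedDet_apply, Finset.mul_sum]
  rw [Finset.sum_comm]
  refine Finset.sum_of_injOn (fun σ : Equiv.Perm (Fin n) => (σ : Fin n → Fin n)) ?_ ?_ ?_ ?_
  · intro σ _ τ _ h
    exact DFunLike.coe_injective h
  · intro σ _
    simp
  · intro f _ hf
    apply sum_sign_det_rows_of_not_surjective
    intro hs
    exact hf ⟨Equiv.ofBijective f (Finite.surjective_iff_bijective.1 hs), by simp, rfl⟩
  · intro σ _
    rfl

/-! ### Multilinear bounds on hulls and spans -/

/-- A bound for a multilinear form on a set extends to any larger set to which bounds for linear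
functionals extend. -/
theorem MultilinearMap.abs_le_of_linear_extension {ι V : Type*} [Fintype ι] [AddCommGroup V]
    [Module ℝ V] (P : MultilinearMap ℝ (fun _ : ι => V) ℝ) {F K : Set V} {S : ℝ}
    (hK : ∀ φ : V →ₗ[ℝ] ℝ, (∀ y ∈ F, |φ y| ≤ S) → ∀ y ∈ K, |φ y| ≤ S)
    (hF : ∀ x : ι → V, (∀ i, x i ∈ F) → |P x| ≤ S) (x : ι → V) (hx : ∀ i, x i ∈ K) :
    |P x| ≤ S := by
  classical
  -- The slots are released from F to K one at a time; s is the set of released slots.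
  have key : ∀ s : Finset ι, ∀ x : ι → V, (∀ i ∈ s, x i ∈ K) → (∀ i ∉ s, x i ∈ F) →
      |P x| ≤ S := by
    intro s
    induction s using Finset.induction_on with
    | empty => exact fun x _ h => hF x fun i => h i (by simp)
    | insert a s ha ih =>
      intro x h1 h2
      have h := hK (P.toLinearMap x a) (fun y hy => by
        rw [MultilinearMap.toLinearMap_apply]
        refine ih _ (fun i hi => ?_) (fun i hi => ?_)
        · have hne : i ≠ a := fun h => ha (h ▸ hi)
          rw [Function.update_of_ne hne]
          exact h1 i (Finset.mem_insert_of_mem hi)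
        · by_cases hia : i = a
          · subst hia; simpa using hy
          · rw [Function.update_of_ne hia]
            exact h2 i (by simp [hia, hi])) (x a) (h1 a (Finset.mem_insert_self _ _))
      simpa using h
  exact key Finset.univ x (fun i _ => hx i) (fun i hi => absurd (Finset.mem_univ i) hi)

theorem LinearMap.abs_le_on_convexHull {V : Type*} [AddCommGroup V] [Module ℝ V]
    {F : Set V} {S : ℝ} (φ : V →ₗ[ℝ] ℝ) (h : ∀ y ∈ F, |φ y| ≤ S) :
    ∀ y ∈ convexHull ℝ (F ∪ -F), |φ y| ≤ S := by
  have hc : Convex ℝ {y | |φ y| ≤ S} := by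
    have : {y | |φ y| ≤ S} = φ ⁻¹' Set.Icc (-S) S := by
      ext y; simp [abs_le]
    rw [this]
    exact (convex_Icc _ _).linear_preimage φ
  refine fun y hy => convexHull_min (fun z hz => ?_) hc hy
  rcases hz with hz | hz
  · exact h z hz
  · have := h (-z) hz
    simpa using this

theorem LinearMap.abs_le_zero_on_span {V : Type*} [AddCommGroup V] [Module ℝ V]
    {F : Set V} (φ : V →ₗ[ℝ] ℝ) (h : ∀ y ∈ F, |φ y| ≤ 0) :
    ∀ y ∈ (Submodule.span ℝ F : Set V), |φ y| ≤ 0 := by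
  intro y hy
  have : Submodule.span ℝ F ≤ LinearMap.ker φ :=
    Submodule.span_le.2 fun z hz => by simpa using h z hz
  simpa using this hy

theorem span_ne_top_of_multilinear_eq_zero {ι V : Type*} [Fintype ι] [AddCommGroup V]
    [Module ℝ V] (P : MultilinearMap ℝ (fun _ : ι => V) ℝ) {F : Set V}
    (hF : ∀ x : ι → V, (∀ i, x i ∈ F) → P x = 0) (z : ι → V) (hz : P z ≠ 0) :
    Submodule.span ℝ F ≠ ⊤ := by
  intro h
  have := P.abs_le_of_linear_extension (F := F) (K := Submodule.span ℝ F) (S := 0)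
    (fun φ => φ.abs_le_zero_on_span) (fun x hx => by simp [hF x hx]) z (fun i => by simp [h])
  exact hz (by simpa using this)

/-! ### Volume from determinants of tuples -/

/-- A set in `ℝ^ι` all of whose `ι`-tuples have determinant at most `D` has volume at most
`4 ^ |ι| D`. -/
theorem volume_le_of_abs_det_le {ι : Type*} [Fintype ι] [DecidableEq ι] {F : Set (ι → ℝ)} {D : ℝ}
    (hF : ∀ x : ι → ι → ℝ, (∀ i, x i ∈ F) → |(Matrix.of x).det| ≤ D) :
    volume F ≤ ENNReal.ofReal (4 ^ Fintype.card ι * D) := by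
  by_cases h0 : ∀ x : ι → ι → ℝ, (∀ i, x i ∈ F) → (Matrix.of x).det = 0
  · have hs := span_ne_top_of_multilinear_eq_zero
      (Matrix.detRowAlternating (n := ι) (R := ℝ)).toMultilinearMap h0 (1 : Matrix ι ι ℝ)
      (by
        have : (1 : Matrix ι ι ℝ).det ≠ 0 := by simp
        exact this)
    have := Measure.addHaar_submodule (volume : Measure (ι → ℝ)) _ hs
    rw [measure_mono_null Submodule.subset_span this]
    exact zero_le
  · push Not at h0
    obtain ⟨x0, hx0, hd0⟩ := h0
    let R : Set ℝ := (fun x : ι → ι → ℝ => |(Matrix.of x).det|) '' {x | ∀ i, x i ∈ F}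
    have hR : BddAbove R := ⟨D, by rintro _ ⟨x, hx, rfl⟩; exact hF x hx⟩
    have hpos : 0 < sSup R := (abs_pos.2 hd0).trans_le (le_csSup hR ⟨x0, hx0, rfl⟩)
    -- The supremum need not be attained; a tuple beyond half of it suffices, and Cramer's rule then
    -- gives every y in F coordinates at most 2 in absolute value in the basis x.
    obtain ⟨_, ⟨x, hx, rfl⟩, hlt⟩ := exists_lt_of_lt_csSup (⟨_, x0, hx0, rfl⟩ : R.Nonempty)
      (half_lt_self hpos)
    have hdx : 0 < |(Matrix.of x).det| := (half_pos hpos).trans hlt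
    have hdx' : (Matrix.of x).det ≠ 0 := abs_pos.1 hdx
    have hsub : F ⊆ Matrix.toLin' (Matrix.of x).transpose '' Set.Icc (fun _ => -2) (fun _ => 2) := by
      intro y hy
      refine ⟨(Matrix.of x).det⁻¹ • (Matrix.of x).transpose.cramer y, ?_, ?_⟩
      · have hb : ∀ i, |((Matrix.of x).det⁻¹ • (Matrix.of x).transpose.cramer y) i| ≤ 2 := by
          intro i
          rw [Pi.smul_apply, Matrix.cramer_transpose_apply, smul_eq_mul, abs_mul, abs_inv,
            inv_mul_le_iff₀ hdx]
          have : |((Matrix.of x).updateRow i y).det| ≤ sSup R := by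
            refine le_csSup hR ⟨Function.update x i y, fun k => ?_, rfl⟩
            by_cases hk : k = i
            · subst hk; simpa using hy
            · simpa [hk] using hx k
          linarith
        exact ⟨fun i => (abs_le.1 (hb i)).1, fun i => (abs_le.1 (hb i)).2⟩
      · rw [Matrix.toLin'_apply, Matrix.mulVec_smul, Matrix.mulVec_cramer, Matrix.det_transpose,
          smul_smul, inv_mul_cancel₀ hdx', one_smul]
    refine (measure_mono hsub).trans ?_
    rw [Measure.addHaar_image_linearMap, LinearMap.det_toLin', Matrix.det_transpose,
      Real.volume_Icc_pi, ENNReal.ofReal_mul (by positivity), mul_comm]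
    refine mul_le_mul' (le_of_eq ?_) (ENNReal.ofReal_le_ofReal (hF x hx))
    rw [Finset.prod_const, ← ENNReal.ofReal_pow (by norm_num)]
    norm_num [Finset.card_univ]

/-! ### The trace form and its Gram determinant -/

/-- Lagrange interpolation at the n + 1 nodes i/(n + 1) in [0, 1] writes p'(0) as a fixed linear
combination of values of p. -/
theorem exists_abs_derivative_eval_zero_le (n : ℕ) : ∃ C : ℝ, 0 ≤ C ∧ ∀ (p : Polynomial ℝ) (b : ℝ),
    p.natDegree ≤ n → (∀ t ∈ Set.Icc (0 : ℝ) 1, |p.eval t| ≤ b) →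
    |p.derivative.eval 0| ≤ C * b := by
  let v : ℕ → ℝ := fun i => i / (n + 1)
  let L : ℕ → Polynomial ℝ := fun i => Lagrange.basis (Finset.range (n + 1)) v i
  have hn : (0 : ℝ) < n + 1 := by positivity
  refine ⟨∑ i ∈ Finset.range (n + 1), |(L i).derivative.eval 0|, by positivity, ?_⟩
  intro p b hp hb
  have hinj : Set.InjOn v (Finset.range (n + 1)) := by
    intro i _ j _ h
    have : (i : ℝ) = j := by
      simpa [v, div_left_inj' hn.ne'] using h
    exact_mod_cast this
  have hdeg : p.degree < (Finset.range (n + 1)).card := by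
    rw [Finset.card_range]
    exact (Polynomial.natDegree_le_iff_degree_le.1 hp).trans_lt (by exact_mod_cast n.lt_succ_self)
  have h := Lagrange.eq_interpolate hinj hdeg
  rw [Lagrange.interpolate_apply] at h
  have h2 : p.derivative.eval 0 =
      ∑ i ∈ Finset.range (n + 1), p.eval (v i) * (L i).derivative.eval 0 := by
    conv_lhs => rw [h]
    simp [Polynomial.eval_finsetSum, L]
  rw [h2, Finset.sum_mul]
  refine (Finset.abs_sum_le_sum_abs _ _).trans (Finset.sum_le_sum fun i hi => ?_)
  rw [abs_mul, mul_comm]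
  refine mul_le_mul_of_nonneg_left (hb _ ⟨by positivity, ?_⟩) (abs_nonneg _)
  have : (i : ℝ) < n + 1 := by exact_mod_cast Finset.mem_range.1 hi
  exact (div_le_one hn).2 this.le

/-- A bound on `det (1 + t X)` for `|t| ≤ 1` controls `tr (X ^ 2)`. -/
theorem exists_abs_trace_sq_le (n : ℕ) : ∃ C : ℝ, 0 ≤ C ∧
    ∀ (X : Matrix (Fin n) (Fin n) ℝ) (b : ℝ),
      (∀ t : ℝ, |t| ≤ 1 → |(1 + t • X).det| ≤ b) → |(X * X).trace| ≤ C * b ^ 2 := by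
  obtain ⟨C, hC, h⟩ := exists_abs_derivative_eval_zero_le n
  refine ⟨C, hC, fun X b hb => ?_⟩
  have hd := Matrix.derivative_det_one_add_X_smul (-(X * X))
  have := h (Matrix.det (1 + (Polynomial.X : Polynomial ℝ) • (-(X * X)).map Polynomial.C)) (b ^ 2)
    (by
      have := Polynomial.natDegree_det_X_add_C_le (-(X * X)) 1
      rw [Matrix.map_one _ (map_zero _) (map_one _), add_comm, Fintype.card_fin] at this
      exact this)
    (by
      intro t ht
      -- Multiplying the values at ±√t gives det(1 - tX²), a polynomial in t whose derivative at 0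
      -- is -tr(X²).
      have e : Polynomial.eval t
          (Matrix.det (1 + (Polynomial.X : Polynomial ℝ) • (-(X * X)).map Polynomial.C)) =
          (1 + Real.sqrt t • X).det * (1 + (-Real.sqrt t) • X).det := by
        rw [← Matrix.det_mul, ← Polynomial.coe_evalRingHom, RingHom.map_det]
        have hm : (1 + Real.sqrt t • X) * (1 + (-Real.sqrt t) • X) = 1 + t • (-(X * X)) := by
          simp only [neg_smul, ← sub_eq_add_neg, add_mul, mul_sub, Matrix.smul_mul, Matrix.mul_smul,
            smul_smul, Real.mul_self_sqrt ht.1, one_mul, mul_one, smul_neg]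
          abel
        rw [hm]
        congr 1
        ext i j
        rw [RingHom.mapMatrix_apply, Matrix.map_apply, Matrix.add_apply, Matrix.smul_apply,
          Matrix.add_apply, Matrix.smul_apply, Matrix.map_apply, Matrix.one_apply, Matrix.one_apply]
        split_ifs <;> simp [mul_comm t]
      have hs : |Real.sqrt t| ≤ 1 := by
        rw [abs_of_nonneg (Real.sqrt_nonneg _)]
        exact Real.sqrt_le_one.2 ht.2
      have h1 := hb _ hs
      have h2 := hb (-Real.sqrt t) (by rwa [abs_neg])
      rw [e, abs_mul, sq]
      exact mul_le_mul h1 h2 (abs_nonneg _) ((abs_nonneg _).trans h1))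
  rw [hd, Matrix.trace_neg, abs_neg] at this
  exact this

-- In entry coordinates tr(QXQY) has matrix Qᵀ ⊗ Q with columns permuted by the swap of indices, of
-- determinant ±det(Q)^(2n). The Gram determinant itself is bounded crudely by the Leibniz
-- expansion.
open scoped Kronecker in
theorem det_sq_mul_det_pow_le {n : ℕ} (Q : Matrix (Fin n) (Fin n) ℝ) {C : ℝ}
    (x : Fin n × Fin n → Matrix (Fin n) (Fin n) ℝ)
    (h : ∀ i j, |(Q * x i * (Q * x j)).trace| ≤ C) :
    (Matrix.of fun i (p : Fin n × Fin n) => x i p.1 p.2).det ^ 2 * |Q.det| ^ (2 * n) ≤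
      (n * n).factorial * C ^ (n * n) := by
  set V : Matrix (Fin n × Fin n) (Fin n × Fin n) ℝ := Matrix.of fun i p => x i p.1 p.2 with hV
  let M : Matrix (Fin n × Fin n) (Fin n × Fin n) ℝ :=
    (Q.transpose ⊗ₖ Q).submatrix id (Equiv.prodComm (Fin n) (Fin n))
  have hG : V * M * V.transpose = Matrix.of fun i j => (Q * x i * (Q * x j)).trace := by
    ext i j
    simp only [Matrix.mul_apply, Matrix.trace, Matrix.diag, Matrix.of_apply, hV, M,
      Matrix.submatrix_apply, Matrix.kroneckerMap_apply, Matrix.transpose_apply, id,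
      Equiv.prodComm_apply, Fintype.sum_prod_type, Finset.sum_mul, Finset.mul_sum, Prod.fst_swap,
      Prod.snd_swap]
    rw [Finset.sum_comm]
    refine Finset.sum_congr rfl fun a _ => ?_
    refine ((Finset.sum_congr rfl fun d _ => Finset.sum_comm).trans Finset.sum_comm).trans ?_
    refine Finset.sum_congr rfl fun c _ => Finset.sum_congr rfl fun d _ =>
      Finset.sum_congr rfl fun b _ => ?_
    ring
  have hdet : |(V * M * V.transpose).det| = V.det ^ 2 * |Q.det| ^ (2 * n) := by
    rw [Matrix.det_mul, Matrix.det_mul, Matrix.det_transpose, abs_mul, abs_mul,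
      Matrix.det_permute', Matrix.det_kronecker, Matrix.det_transpose, abs_mul, ← pow_add, abs_pow,
      Fintype.card_fin, ← two_mul]
    have : |(((Equiv.Perm.sign (Equiv.prodComm (Fin n) (Fin n)) : ℤˣ) : ℤ) : ℝ)| = 1 := by
      rcases Int.units_eq_one_or (Equiv.Perm.sign (Equiv.prodComm (Fin n) (Fin n))) with h | h <;>
        simp [h]
    rw [this, one_mul, mul_right_comm, abs_mul_abs_self, sq]
  rw [← hdet, hG]
  have := Matrix.det_le (abv := AbsoluteValue.abs)
    (A := Matrix.of fun i j => (Q * x i * (Q * x j)).trace) (x := C) (fun i j => h i j)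
  simpa [Fintype.card_prod] using this

/-! ### Coordinates and the symmetric convex hull -/

/-- The entries of a matrix as a vector indexed by pairs. -/
def matrixVec (n : ℕ) : Matrix (Fin n) (Fin n) ℝ ≃ₗ[ℝ] (Fin n × Fin n → ℝ) :=
  (Matrix.ofLinearEquiv ℝ).symm.trans (LinearEquiv.curry ℝ ℝ (Fin n) (Fin n)).symm

theorem matrixVec_apply {n : ℕ} (M : Matrix (Fin n) (Fin n) ℝ) (p : Fin n × Fin n) :
    matrixVec n M p = M p.1 p.2 := rfl

/-- Uniqueness of Haar measure makes the two measures proportional; the factor is absorbed into the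
final constant. -/
theorem exists_matrixVolume_eq (n : ℕ) : ∃ c : ℝ≥0, ∀ F : Set (Matrix (Fin n) (Fin n) ℝ),
    matrixVolume n F = c * volume (matrixVec n '' F) := by
  let L : (Fin n → Fin n → ℝ) ≃L[ℝ] (Fin n × Fin n → ℝ) :=
    (LinearEquiv.curry ℝ ℝ (Fin n) (Fin n)).symm.toContinuousLinearEquiv
  let e := L.toHomeomorph.toMeasurableEquiv
  have hH : (Measure.map e volume).IsAddHaarMeasure := L.isAddHaarMeasure_map volume
  refine ⟨Measure.addHaarScalarFactor (Measure.map e volume) volume, fun F => ?_⟩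
  have h1 : matrixVolume n = (volume : Measure (Fin n → Fin n → ℝ)) := Measure.map_id
  have h2 : ∀ G : Set (Fin n → Fin n → ℝ), volume G = Measure.map e volume (e '' G) := by
    intro G
    rw [e.map_apply, e.preimage_image]
  have h3 := Measure.isAddLeftInvariant_eq_smul (Measure.map e volume) volume
  rw [h1]
  refine (h2 F).trans ?_
  conv_lhs => rw [h3]
  rfl

theorem abs_det_le_of_abs_mixedDet_le {n : ℕ} {F : Set (Matrix (Fin n) (Fin n) ℝ)} {S : ℝ}
    (hF : ∀ x : Fin n → Matrix (Fin n) (Fin n) ℝ, (∀ i, x i ∈ F) → |mixedDet n x| ≤ S)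
    {A : Matrix (Fin n) (Fin n) ℝ} (hA : A ∈ convexHull ℝ (F ∪ -F)) : |A.det| ≤ S := by
  have h := (mixedDet n).abs_le_of_linear_extension (K := convexHull ℝ (F ∪ -F))
    (fun φ => φ.abs_le_on_convexHull) hF (fun _ => A) (fun _ => hA)
  rw [mixedDet_const, abs_mul, Nat.abs_cast] at h
  have h1 : (1 : ℝ) ≤ n.factorial := by exact_mod_cast n.factorial_pos
  nlinarith [abs_nonneg A.det]

theorem neg_mem_convexHull_symm {V : Type*} [AddCommGroup V] [Module ℝ V] {F : Set V} {x : V}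
    (hx : x ∈ convexHull ℝ (F ∪ -F)) : -x ∈ convexHull ℝ (F ∪ -F) := by
  have : -(F ∪ -F) = F ∪ -F := by rw [Set.union_neg, neg_neg, Set.union_comm]
  rw [← this, convexHull_neg]
  simpa using hx

theorem smul_mem_of_convex_symm {V : Type*} [AddCommGroup V] [Module ℝ V] {K : Set V}
    (hK : Convex ℝ K) (hs : ∀ x ∈ K, -x ∈ K) {x : V} (hx : x ∈ K) {t : ℝ} (ht : |t| ≤ 1) :
    t • x ∈ K := by
  have ht := abs_le.1 ht
  have h := hK hx (hs x hx) (a := (1 + t) / 2) (b := (1 - t) / 2) (by linarith) (by linarith)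
    (by ring)
  convert h using 1
  rw [smul_neg, ← sub_eq_add_neg, ← sub_smul]
  congr 1
  ring

/-- The degenerate case, where no invertible A is available: the polarization vanishes on F but
equals n! at the identity, so F spans a proper subspace. -/
theorem volume_matrixVec_eq_zero {n : ℕ} {F : Set (Matrix (Fin n) (Fin n) ℝ)}
    (h : ∀ A ∈ convexHull ℝ (F ∪ -F), A.det = 0) : volume (matrixVec n '' F) = 0 := by
  rcases F.eq_empty_or_nonempty with rfl | ⟨x0, hx0⟩
  · simp
  -- The empty matrix has determinant 1, so n = 0 contradicts the hypothesis.
  rcases Nat.eq_zero_or_pos n with rfl | hn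
  · have := h x0 (subset_convexHull _ _ (Or.inl hx0))
    simp at this
  set K := convexHull ℝ (F ∪ -F)
  have hFK : F ⊆ K := fun x hx => subset_convexHull _ _ (Or.inl hx)
  have hK : Convex ℝ K := convex_convexHull _ _
  have h0 : (0 : Matrix (Fin n) (Fin n) ℝ) ∈ K := by
    simpa using smul_mem_of_convex_symm hK (fun x => neg_mem_convexHull_symm) (hFK hx0) (t := 0)
      (by simp)
  have hP : ∀ x : Fin n → Matrix (Fin n) (Fin n) ℝ, (∀ i, x i ∈ F) → mixedDet n x = 0 := by
    intro x hx
    have := mixedDet_sub x 0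
    rw [sub_zero] at this
    rw [this]
    refine Finset.sum_eq_zero fun s _ => ?_
    have hn' : (n : ℝ) ≠ 0 := by exact_mod_cast hn.ne'
    -- Dividing by n turns each subset sum into a convex combination of points of K, one of which
    -- may be 0.
    have hm : ∑ j, (n : ℝ)⁻¹ • s.piecewise 0 x j ∈ K := by
      refine hK.sum_mem (fun _ _ => by positivity) (by simp [hn']) fun j _ => ?_
      by_cases hj : j ∈ s
      · simpa [hj] using h0
      · simpa [hj] using hFK (hx j)
    have hd := h _ hm
    rw [← Finset.smul_sum, Matrix.det_smul] at hd
    rw [(mul_eq_zero.1 hd).resolve_left (by positivity), mul_zero]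
  have hs := span_ne_top_of_multilinear_eq_zero
    ((mixedDet n).compLinearMap (fun _ => (matrixVec n).symm.toLinearMap))
    (F := matrixVec n '' F) (fun x hx => hP _ fun i => by
      obtain ⟨y, hy, hxy⟩ := hx i
      simpa [← hxy] using hy) (fun _ => matrixVec n 1) (by
        simp [mixedDet_const, n.factorial_ne_zero])
  exact measure_mono_null Submodule.subset_span
    (Measure.addHaar_submodule (volume : Measure (Fin n × Fin n → ℝ)) _ hs)

theorem trace_mul_comm_polar {n : ℕ} (Q X Y : Matrix (Fin n) (Fin n) ℝ) :
    (Q * X * (Q * Y)).trace =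
      (Q * ((1 / 2 : ℝ) • X + (1 / 2 : ℝ) • Y) * (Q * ((1 / 2 : ℝ) • X + (1 / 2 : ℝ) • Y))).trace -
      (Q * ((1 / 2 : ℝ) • X + (1 / 2 : ℝ) • -Y) *
        (Q * ((1 / 2 : ℝ) • X + (1 / 2 : ℝ) • -Y))).trace := by
  have hc := Matrix.trace_mul_comm (Q * Y) (Q * X)
  simp only [mul_add, add_mul, Matrix.mul_smul, Matrix.smul_mul, mul_neg, neg_mul,
    Matrix.trace_add, Matrix.trace_smul, Matrix.trace_neg, smul_neg, smul_eq_mul]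
  rw [hc]
  ring

/-! ### The volume bound -/

/-- Sets on which the polarized determinant is bounded have bounded volume. -/
theorem exists_volume_matrixVec_le (n : ℕ) : ∃ C : ℝ, 0 ≤ C ∧
    ∀ (F : Set (Matrix (Fin n) (Fin n) ℝ)) (S : ℝ), 0 ≤ S →
      (∀ x : Fin n → Matrix (Fin n) (Fin n) ℝ, (∀ i, x i ∈ F) → |mixedDet n x| ≤ S) →
      volume (matrixVec n '' F) ≤ ENNReal.ofReal (C * S ^ n) := by
  obtain ⟨C₁, hC₁, htr⟩ := exists_abs_trace_sq_le n
  -- Two copies of the bound on tr((QX)²), for the midpoints (X + Y)/2 and (X - Y)/2 of the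
  -- polarization identity.
  let C₂ : ℝ := C₁ * (2 * 2 ^ n) ^ 2 + C₁ * (2 * 2 ^ n) ^ 2
  have hC₂ : 0 ≤ C₂ := by positivity
  let C₃ : ℝ := Real.sqrt ((n * n).factorial * C₂ ^ (n * n))
  refine ⟨4 ^ (n * n) * C₃, by positivity, fun F S hS hF => ?_⟩
  set K := convexHull ℝ (F ∪ -F)
  by_cases h0 : ∀ A ∈ K, A.det = 0
  · rw [volume_matrixVec_eq_zero h0]
    exact zero_le
  push Not at h0
  obtain ⟨A₀, hA₀, hd₀⟩ := h0
  have hFK : F ⊆ K := fun x hx => subset_convexHull _ _ (Or.inl hx)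
  have hK : Convex ℝ K := convex_convexHull _ _
  have hsymm : ∀ x ∈ K, -x ∈ K := fun x => neg_mem_convexHull_symm
  have hdet : ∀ A ∈ K, |A.det| ≤ S := fun A => abs_det_le_of_abs_mixedDet_le hF
  let R : Set ℝ := (fun A => |A.det|) '' K
  have hR : BddAbove R := ⟨S, by rintro _ ⟨x, hx, rfl⟩; exact hdet x hx⟩
  have hpos : 0 < sSup R := (abs_pos.2 hd₀).trans_le (le_csSup hR ⟨A₀, hA₀, rfl⟩)
  obtain ⟨_, ⟨A, hA, rfl⟩, hlt⟩ := exists_lt_of_lt_csSup (⟨_, A₀, hA₀, rfl⟩ : R.Nonempty)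
    (half_lt_self hpos)
  have hdA : 0 < |A.det| := (half_pos hpos).trans hlt
  have hu : IsUnit A.det := isUnit_iff_ne_zero.2 (abs_pos.1 hdA)
  set Q := A⁻¹
  have hQA : Q * A = 1 := Matrix.nonsing_inv_mul A hu
  have hdQ : |Q.det| * |A.det| = 1 := by rw [← abs_mul, ← Matrix.det_mul, hQA]; simp
  have hquad : ∀ X ∈ K, |(Q * X * (Q * X)).trace| ≤ C₁ * (2 * 2 ^ n) ^ 2 := by
    intro X hX
    refine htr _ _ fun t ht => ?_
    have hm := hK hA (smul_mem_of_convex_symm hK hsymm hX ht) (a := 1 / 2) (b := 1 / 2)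
      (by norm_num) (by norm_num) (by norm_num)
    -- The midpoint of A and tX lies in K, where |det| ≤ 2|det A|; undoing the halving costs 2^n,
    -- and |det Q| cancels |det A|.
    have e : 1 + t • (Q * X) = Q * ((2 : ℝ) • ((1 / 2 : ℝ) • A + (1 / 2 : ℝ) • t • X)) := by
      rw [smul_add, smul_smul, smul_smul, mul_add]
      norm_num [hQA]
    rw [e, Matrix.det_mul, Matrix.det_smul, abs_mul, abs_mul, Fintype.card_fin, abs_pow, abs_two]
    have h1 : |((1 / 2 : ℝ) • A + (1 / 2 : ℝ) • t • X).det| ≤ 2 * |A.det| :=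
      (le_csSup hR ⟨_, hm, rfl⟩).trans (by linarith)
    calc _ ≤ |Q.det| * (2 ^ n * (2 * |A.det|)) := by gcongr
      _ = 2 * 2 ^ n * (|Q.det| * |A.det|) := by ring
      _ = 2 * 2 ^ n := by rw [hdQ, mul_one]
  have hbil : ∀ X ∈ K, ∀ Y ∈ K, |(Q * X * (Q * Y)).trace| ≤ C₂ := by
    intro X hX Y hY
    have h1 := hquad _ (hK hX hY (a := 1 / 2) (b := 1 / 2) (by norm_num) (by norm_num) (by norm_num))
    have h2 := hquad _ (hK hX (hsymm Y hY) (a := 1 / 2) (b := 1 / 2) (by norm_num) (by norm_num)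
      (by norm_num))
    rw [trace_mul_comm_polar]
    exact (abs_sub _ _).trans (add_le_add h1 h2)
  have hvol := volume_le_of_abs_det_le (F := matrixVec n '' F) (D := C₃ * S ^ n) (by
    intro x hx
    choose y hyF hyx using hx
    have h := det_sq_mul_det_pow_le Q (C := C₂) y
      fun i j => hbil _ (hFK (hyF i)) _ (hFK (hyF j))
    have e : (Matrix.of fun i (p : Fin n × Fin n) => y i p.1 p.2) = Matrix.of x := by
      ext i p
      rw [Matrix.of_apply, Matrix.of_apply, ← hyx i, matrixVec_apply]
    rw [e] at h
    have h2 : (Matrix.of x).det ^ 2 ≤ (C₃ * S ^ n) ^ 2 := by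
      calc (Matrix.of x).det ^ 2
          = (Matrix.of x).det ^ 2 * |Q.det| ^ (2 * n) * |A.det| ^ (2 * n) := by
            rw [mul_assoc, ← mul_pow, hdQ, one_pow, mul_one]
        _ ≤ ((n * n).factorial * C₂ ^ (n * n)) * S ^ (2 * n) := by
            gcongr
            exact hdet A hA
        _ = (C₃ * S ^ n) ^ 2 := by
            rw [mul_pow, Real.sq_sqrt (by positivity), ← pow_mul, mul_comm n 2]
    exact abs_le_of_sq_le_sq h2 (by positivity))
  rw [Fintype.card_prod, Fintype.card_fin] at hvol
  rwa [mul_assoc]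

/-! ### From determinants on E to the theorem -/

theorem volume_matrixVec_image_add {n : ℕ} (E : Set (Matrix (Fin n) (Fin n) ℝ))
    (A : Matrix (Fin n) (Fin n) ℝ) :
    volume (matrixVec n '' ((fun M => M + A) '' E)) = volume (matrixVec n '' E) := by
  have h : matrixVec n '' ((fun M => M + A) '' E) =
      (fun v => v + matrixVec n A) '' (matrixVec n '' E) := by
    simp only [Set.image_image, map_add]
  rw [h, Set.image_add_right, measure_preimage_add_right]

/-- Each of the 2^n terms in the iterated difference of the c_j-scaled matrices is a determinant of
an admissible combination of points of E. -/
theorem abs_mixedDet_sub_le {n : ℕ} {E : Set (Matrix (Fin n) (Fin n) ℝ)} {c : Fin n → ℝ} {t : ℝ}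
    (ht : ∀ M : Fin n → Matrix (Fin n) (Fin n) ℝ, (∀ j, M j ∈ E) → |(∑ j, c j • M j).det| ≤ t)
    {A A' : Fin n → Matrix (Fin n) (Fin n) ℝ} (hA : ∀ j, A j ∈ E) (hA' : ∀ j, A' j ∈ E) :
    (∏ j, |c j|) * |mixedDet n (A - A')| ≤ 2 ^ n * t := by
  have h := mixedDet_sub (fun j => c j • A j) (fun j => c j • A' j)
  have e : (fun j => c j • A j) - (fun j => c j • A' j) = fun j => c j • (A - A') j := by
    funext j
    simp [smul_sub]
  rw [e, MultilinearMap.map_smul_univ, smul_eq_mul] at h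
  rw [← Finset.abs_prod, ← abs_mul, h]
  refine (Finset.abs_sum_le_sum_abs _ _).trans ?_
  have : ∀ s ∈ (Finset.univ : Finset (Finset (Fin n))), |(-1 : ℝ) ^ s.card *
      (∑ j, s.piecewise (fun j => c j • A' j) (fun j => c j • A j) j).det| ≤ t := by
    intro s _
    rw [abs_mul, abs_pow, abs_neg, abs_one, one_pow, one_mul]
    have e2 : ∀ j, s.piecewise (fun j => c j • A' j) (fun j => c j • A j) j =
        c j • s.piecewise A' A j := by
      intro j
      by_cases hj : j ∈ s <;> simp [hj]
    simp only [e2]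
    refine ht _ fun j => ?_
    by_cases hj : j ∈ s
    · simpa [hj] using hA' j
    · simpa [hj] using hA j
  refine (Finset.sum_le_card_nsmul _ _ _ this).trans ?_
  simp [Fintype.card_finset]

theorem exists_matrixVolume_rpow_le (n : ℕ) (hn : 1 ≤ n) :
    ∃ A : ℝ≥0, ∀ E : Set (Matrix (Fin n) (Fin n) ℝ), ∀ c : Fin n → ℝ, (∀ j, c j ≠ 0) →
      ENNReal.ofReal (∏ j, |c j|) * matrixVolume n E ^ (1 / (n : ℝ)) ≤
        A * ⨆ (M : Fin n → Matrix (Fin n) (Fin n) ℝ) (_ : ∀ j, M j ∈ E),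
          ENNReal.ofReal |(∑ j, c j • M j).det| := by
  obtain ⟨k, hk⟩ := exists_matrixVolume_eq n
  obtain ⟨C, hC, hvol⟩ := exists_volume_matrixVec_le n
  have hn' : (n : ℝ) ≠ 0 := by positivity
  -- The added 1 keeps the constant nonzero, so an infinite supremum makes the right side infinite.
  refine ⟨Real.toNNReal ((k * C : ℝ) ^ (1 / (n : ℝ)) * 2 ^ n) + 1, fun E c hc => ?_⟩
  set T := ⨆ (M : Fin n → Matrix (Fin n) (Fin n) ℝ) (_ : ∀ j, M j ∈ E),
    ENNReal.ofReal |(∑ j, c j • M j).det|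
  rcases eq_or_ne T ⊤ with h | h
  · rw [h, ENNReal.mul_top (by simp)]
    exact le_top
  rcases E.eq_empty_or_nonempty with rfl | ⟨A₀, hA₀⟩
  · rw [hk, Set.image_empty, measure_empty, mul_zero, ENNReal.zero_rpow_of_pos (by positivity),
      mul_zero]
    exact zero_le
  have ht : ∀ M : Fin n → Matrix (Fin n) (Fin n) ℝ, (∀ j, M j ∈ E) →
      |(∑ j, c j • M j).det| ≤ T.toReal := by
    intro M hM
    rw [← ENNReal.ofReal_le_iff_le_toReal h]
    exact le_iSup₂_of_le M hM le_rfl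
  have hp : 0 < ∏ j, |c j| := Finset.prod_pos fun j _ => abs_pos.2 (hc j)
  set S : ℝ := 2 ^ n * T.toReal / ∏ j, |c j| with hS
  have hS0 : 0 ≤ S := by positivity
  -- One base point in E suffices: the translate E - A₀ consists of differences of points of E and
  -- has the same volume.
  have hb := hvol ((fun M => M + -A₀) '' E) S hS0 (by
    intro x hx
    choose y hy hyx using hx
    have e : x = y - fun _ => A₀ := by
      funext i
      rw [← hyx i, Pi.sub_apply, sub_eq_add_neg]
    rw [hS, le_div_iff₀ hp, mul_comm, e]
    exact abs_mixedDet_sub_le ht hy fun _ => hA₀)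
  rw [volume_matrixVec_image_add] at hb
  have h1 : matrixVolume n E ^ (1 / (n : ℝ)) ≤ ENNReal.ofReal ((k * C : ℝ) ^ (1 / (n : ℝ)) * S) := by
    have h2 : matrixVolume n E ≤ ENNReal.ofReal (k * C * S ^ n) := by
      rw [hk, mul_assoc, ENNReal.ofReal_mul k.coe_nonneg, ENNReal.ofReal_coe_nnreal]
      gcongr
    refine (ENNReal.rpow_le_rpow h2 (by positivity)).trans (le_of_eq ?_)
    rw [ENNReal.ofReal_rpow_of_nonneg (by positivity) (by positivity),
      Real.mul_rpow (by positivity) (by positivity), one_div,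
      Real.pow_rpow_inv_natCast hS0 (by omega)]
  calc ENNReal.ofReal (∏ j, |c j|) * matrixVolume n E ^ (1 / (n : ℝ))
      ≤ ENNReal.ofReal (∏ j, |c j|) * ENNReal.ofReal ((k * C : ℝ) ^ (1 / (n : ℝ)) * S) := by gcongr
    _ = ENNReal.ofReal ((k * C : ℝ) ^ (1 / (n : ℝ)) * 2 ^ n) * T := by
        conv_rhs => rw [← ENNReal.ofReal_toReal h]
        rw [← ENNReal.ofReal_mul hp.le, ← ENNReal.ofReal_mul (by positivity), hS]
        congr 1
        field_simp
    _ ≤ _ := by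
        refine mul_le_mul_left ?_ T
        rw [ENNReal.coe_add]
        exact le_self_add

theorem mainTheorem2 (n : ℕ) (hn : 1 ≤ n) :
    ∃ A B : ℝ≥0,
      (∀ E : Set (Matrix (Fin n) (Fin n) ℝ),
        NullMeasurableSet E (matrixVolume n) → matrixVolume n E < ∞ →
        ∀ c : Fin n → ℝ, (∀ j, c j ≠ 0) →
          ENNReal.ofReal (∏ j, |c j|) * matrixVolume n E ^ (1 / (n : ℝ)) ≤
            A * ⨆ (M : Fin n → Matrix (Fin n) (Fin n) ℝ) (_ : ∀ j, M j ∈ E),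
              ENNReal.ofReal |(∑ j, c j • M j).det|) ∧
      (∀ E : Set (Matrix (Fin n) (Fin n) ℝ), IsCompact E → Convex ℝ E →
        matrixVolume n E ^ (1 / (n : ℝ)) ≤
          B * ⨆ (M : Matrix (Fin n) (Fin n) ℝ) (_ : M ∈ E), ENNReal.ofReal |M.det|) := by
  obtain ⟨A, hA⟩ := exists_matrixVolume_rpow_le n hn
  refine ⟨A, (n : ℝ≥0) ^ n * A, fun E _ _ c hc => hA E c hc, fun E _ hE => ?_⟩
  have hn' : (n : ℝ) ≠ 0 := by positivity
  -- With equal weights 1/n the combinations are averages, which stay in the convex set E; the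
  -- product of weights n^(-n) accounts for the factor n^n.
  have h := hA E (fun _ => (n : ℝ)⁻¹) (fun _ => inv_ne_zero hn')
  have hsup : (⨆ (M : Fin n → Matrix (Fin n) (Fin n) ℝ) (_ : ∀ j, M j ∈ E),
      ENNReal.ofReal |(∑ j, (n : ℝ)⁻¹ • M j).det|) ≤
      ⨆ (M : Matrix (Fin n) (Fin n) ℝ) (_ : M ∈ E), ENNReal.ofReal |M.det| :=
    iSup₂_le fun M hM => le_iSup₂_of_le (∑ j, (n : ℝ)⁻¹ • M j)
      (hE.sum_mem (fun _ _ => by positivity) (by simp [hn']) fun j _ => hM j) le_rfl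
  have hone : ((n : ℝ≥0) ^ n : ℝ≥0∞) * ENNReal.ofReal (∏ _j : Fin n, |(n : ℝ)⁻¹|) = 1 := by
    have e : ((n : ℝ≥0) ^ n : ℝ≥0∞) = ENNReal.ofReal ((n : ℝ) ^ n) := by
      rw [ENNReal.ofReal_pow (by positivity), ENNReal.ofReal_natCast, ENNReal.coe_natCast]
    rw [e, ← ENNReal.ofReal_mul (by positivity), Finset.prod_const, Finset.card_univ,
      Fintype.card_fin, abs_inv, Nat.abs_cast, ← mul_pow, mul_inv_cancel₀ hn', one_pow,
      ENNReal.ofReal_one]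
  calc matrixVolume n E ^ (1 / (n : ℝ))
      = ((n : ℝ≥0) ^ n : ℝ≥0∞) * (ENNReal.ofReal (∏ _j : Fin n, |(n : ℝ)⁻¹|) *
          matrixVolume n E ^ (1 / (n : ℝ))) := by rw [← mul_assoc, hone, one_mul]
    _ ≤ ((n : ℝ≥0) ^ n : ℝ≥0∞) *
        (A * ⨆ (M : Matrix (Fin n) (Fin n) ℝ) (_ : M ∈ E), ENNReal.ofReal |M.det|) :=
        mul_le_mul_right (h.trans (mul_le_mul_right hsup _)) _
    _ = _ := by rw [ENNReal.coe_mul, ENNReal.coe_pow, mul_assoc]
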